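/- Let $n\ge 1$ be an integer, let $A$ be any complex $n\times n$ matrix and let $B$ be a Hermitian complex $n\times n$ matrix. For a square matrix $X$ write $|X|=(X^*X)^{1/2}$ for its modulus, and for real $q>0$ let $|X|^q$ be the $q$-th power of this positive semidefinite matrix. Then for every real $q\ge 1$ and every unitarily invariant norm $|||\cdot|||$ on the complex $n\times n$ matrices (that is, every norm satisfying $|||UXV|||=|||X|||$ for all $X$ and all unitary $U,V$), $$|||\,|ABA^*|^q\,|||\le|||\,|A|^q\,|B|^q\,|A|^q\,|||.$$ -/

import Mathlib

open scoped MatrixOrder Matrix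

/-- `N` is a unitarily invariant norm on the space of complex `n × n` matrices: a norm on this
complex vector space with `N (U * X * V) = N X` for all matrices `X` and all unitary `U`, `V`.
No normalization and no submultiplicativity is required. -/
structure IsUnitarilyInvariantNorm {n : Type*} [Fintype n] [DecidableEq n]
    (N : Matrix n n ℂ → ℝ) : Prop where
  add_le : ∀ X Y : Matrix n n ℂ, N (X + Y) ≤ N X + N Y
  smul_eq : ∀ (c : ℂ) (X : Matrix n n ℂ), N (c • X) = ‖c‖ * N X
  eq_zero : ∀ X : Matrix n n ℂ, N X = 0 → X = 0
  unitary_mul_mul : ∀ U ∈ Matrix.unitaryGroup n ℂ, ∀ V ∈ Matrix.unitaryGroup n ℂ,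
    ∀ X : Matrix n n ℂ, N (U * X * V) = N X

/-- `matrixAbsPow X q` is `|X| ^ q`, where `|X| = (Xᴴ * X) ^ (1/2)` is the modulus of the square
matrix `X` and the real power of the positive semidefinite matrix `|X|` is taken by the functional
calculus. -/
noncomputable def matrixAbsPow {n : Type*} [Fintype n] [DecidableEq n]
    (X : Matrix n n ℂ) (q : ℝ) : Matrix n n ℂ :=
  CFC.rpow (CFC.abs X) q

/-! By Fan dominance, it suffices to compare sums of the `k` largest eigenvalues of the two positive
semidefinite matrices, and weak log-majorization gives these sums from products. The product of the
`k` largest eigenvalues is the operator norm of the `k`-th antisymmetric power, which is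
multiplicative and compatible with adjoints and powers, so each product inequality becomes an
operator norm inequality.

Write `C = |B|^(1/2)` and `B = C S C` with `S` unitary. Then `A B Aᴴ = (A C) S (A C)ᴴ` has norm at
most `‖|A| C‖ ^ 2` in each antisymmetric power. Cordes' inequality `‖a^t b^t‖ ≤ ‖a b‖^t` at `t =
1/q` bounds this by `‖|A|^q |B|^(q/2)‖ ^ (2/q)`, and the square of that last norm is the norm of
`|A|^q |B|^q |A|^q`. The main lemmas are `norm_semigroup_mul_le_rpow`, `norm_antisymmPow_diagonal`,
`sum_range_le_of_prod_range_le` and `mem_convexHull_signed_perm`. -/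

/-! ### Majorization of real sequences. -/

/-- Abel summation: lowering the common weight from `w m` to `w (m + 1)` only decreases its product
with a nonnegative partial sum. The full sum on the left may be negative. -/
theorem mul_sum_range_le_sum_mul {w c : ℕ → ℝ} (hw : Antitone w) (m : ℕ)
    (hc : ∀ k ≤ m, 0 ≤ ∑ i ∈ Finset.range k, c i) :
    w m * ∑ i ∈ Finset.range (m + 1), c i ≤ ∑ i ∈ Finset.range (m + 1), w i * c i := by
  induction m with
  | zero => simp
  | succ m ih =>
    rw [Finset.sum_range_succ, Finset.sum_range_succ (fun i => w i * c i), mul_add]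
    have h1 := ih fun k hk => hc k (hk.trans m.le_succ)
    have h2 := mul_le_mul_of_nonneg_right (hw m.le_succ) (hc (m + 1) le_rfl)
    simp only [Nat.succ_eq_add_one] at h2
    linarith

theorem sum_mul_nonneg_of_antitone {w c : ℕ → ℝ} (hw : Antitone w) (hw0 : ∀ i, 0 ≤ w i) (m : ℕ)
    (hc : ∀ k ≤ m, 0 ≤ ∑ i ∈ Finset.range k, c i) :
    0 ≤ ∑ i ∈ Finset.range m, w i * c i := by
  cases m with
  | zero => simp
  | succ m =>
    exact (mul_nonneg (hw0 m) (hc _ le_rfl)).trans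
      (mul_sum_range_le_sum_mul hw m fun k hk => hc k (hk.trans m.le_succ))

/-- Weak log-majorization implies weak majorization. -/
theorem sum_range_le_of_prod_range_le {x y : ℕ → ℝ} (hx : Antitone x) (hx0 : ∀ i, 0 ≤ x i)
    (hy0 : ∀ i, 0 ≤ y i) (m : ℕ)
    (h : ∀ k ≤ m, ∏ i ∈ Finset.range k, x i ≤ ∏ i ∈ Finset.range k, y i) :
    ∑ i ∈ Finset.range m, x i ≤ ∑ i ∈ Finset.range m, y i := by
  induction m with
  | zero => simp
  | succ m ih =>
    -- Logarithms need positive entries. If `x m = 0` the last term is harmless; otherwise all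
    -- entries of `x` are positive by monotonicity, and those of `y` by the product inequality.
    rcases (hx0 m).eq_or_lt with h0 | hpos
    · rw [Finset.sum_range_succ, Finset.sum_range_succ, ← h0, add_zero]
      exact (ih fun k hk => h k (hk.trans m.le_succ)).trans (le_add_of_nonneg_right (hy0 m))
    · have hxp : ∀ i < m + 1, 0 < x i := fun i hi => hpos.trans_le (hx (Nat.lt_succ_iff.mp hi))
      have hyp : ∀ i < m + 1, 0 < y i := by
        intro i hi
        have h1 : 0 < ∏ j ∈ Finset.range (m + 1), y j :=
          (Finset.prod_pos fun j hj => hxp j (Finset.mem_range.mp hj)).trans_le (h _ le_rfl)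
        refine (hy0 i).lt_of_ne fun h2 => h1.ne' ?_
        exact Finset.prod_eq_zero (Finset.mem_range.mpr hi) h2.symm
      have key := sum_mul_nonneg_of_antitone (c := fun i => Real.log (y i) - Real.log (x i))
        hx hx0 (m + 1) (by
          intro k hk
          have hxk : ∀ i ∈ Finset.range k, 0 < x i := fun i hi =>
            hxp i ((Finset.mem_range.mp hi).trans_le hk)
          have hyk : ∀ i ∈ Finset.range k, 0 < y i := fun i hi =>
            hyp i ((Finset.mem_range.mp hi).trans_le hk)
          rw [Finset.sum_sub_distrib, ← Real.log_prod fun i hi => (hyk i hi).ne',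
            ← Real.log_prod fun i hi => (hxk i hi).ne', sub_nonneg]
          exact Real.log_le_log (Finset.prod_pos hxk) (h k hk))
      -- Termwise, this is `log u ≤ u - 1` at `u = y i / x i`.
      have h2 : ∑ i ∈ Finset.range (m + 1), x i * (Real.log (y i) - Real.log (x i)) ≤
          ∑ i ∈ Finset.range (m + 1), (y i - x i) := by
        refine Finset.sum_le_sum fun i hi => ?_
        have hxi := hxp i (Finset.mem_range.mp hi)
        have hyi := hyp i (Finset.mem_range.mp hi)
        have h3 := Real.log_le_sub_one_of_pos (div_pos hyi hxi)
        rw [Real.log_div hyi.ne' hxi.ne'] at h3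
        have h4 := mul_le_mul_of_nonneg_left h3 hxi.le
        rwa [mul_sub (x i) (y i / x i), mul_div_cancel₀ _ hxi.ne', mul_one] at h4
      rw [Finset.sum_sub_distrib] at h2
      linarith

/-- Extension of a finite sequence by zero. -/
noncomputable def zeroExtend {m : ℕ} (x : Fin m → ℝ) (i : ℕ) : ℝ :=
  if h : i < m then x ⟨i, h⟩ else 0

theorem zeroExtend_val {m : ℕ} (x : Fin m → ℝ) (i : Fin m) : zeroExtend x i = x i := by
  simp [zeroExtend]

theorem zeroExtend_nonneg {m : ℕ} {x : Fin m → ℝ} (hx : ∀ i, 0 ≤ x i) (i : ℕ) :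
    0 ≤ zeroExtend x i := by
  unfold zeroExtend
  split_ifs
  exacts [hx _, le_rfl]

theorem zeroExtend_antitone {m : ℕ} {x : Fin m → ℝ} (hx : Antitone x) (hx0 : ∀ i, 0 ≤ x i) :
    Antitone (zeroExtend x) := by
  intro i j hij
  by_cases hj : j < m
  · have hi := hij.trans_lt hj
    simpa [zeroExtend, hi, hj] using hx (show (⟨i, hi⟩ : Fin m) ≤ ⟨j, hj⟩ from hij)
  · simpa [zeroExtend, hj] using zeroExtend_nonneg hx0 i

/-- A vector weakly majorized by `y` lies in the convex hull of the signed permutations of `y`. -/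
theorem mem_convexHull_signed_perm {m : ℕ} {x y : Fin m → ℝ} (hx0 : ∀ i, 0 ≤ x i)
    (hx : Antitone x)
    (h : ∀ k ≤ m, ∑ i ∈ Finset.range k, zeroExtend x i ≤ ∑ i ∈ Finset.range k, zeroExtend y i) :
    x ∈ convexHull ℝ (Set.range fun p : Equiv.Perm (Fin m) × (Fin m → ℤˣ) =>
      fun i => ((p.2 i : ℤ) : ℝ) * y (p.1 i)) := by
  by_contra hmem
  -- A separating functional is contradicted by the signed permutation of `y` that matches its
  -- coefficients in sign and in order of modulus.
  obtain ⟨f, u, hf, hfx⟩ := geometric_hahn_banach_closed_point (convex_convexHull ℝ _)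
    ((Set.finite_range _).isClosed_convexHull ℝ) hmem
  set l : Fin m → ℝ := fun i => f (Pi.single i 1) with hl
  have hfl : ∀ v : Fin m → ℝ, f v = ∑ i, l i * v i := by
    intro v
    have := LinearMap.pi_apply_eq_sum_univ f.toLinearMap v
    simp only [ContinuousLinearMap.coe_coe, smul_eq_mul] at this
    rw [this]
    refine Finset.sum_congr rfl fun i _ => ?_
    rw [mul_comm, hl]
    congr 2
    ext j
    simp [Pi.single_apply, eq_comm]
  obtain ⟨σ, hσ⟩ : ∃ σ : Equiv.Perm (Fin m), Antitone fun i => |l (σ i)| := by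
    refine ⟨Tuple.sort fun i => -|l i|, fun i j hij => ?_⟩
    have := Tuple.monotone_sort (fun i => -|l i|) hij
    simpa using this
  have h1 : f x ≤ ∑ i, |l (σ i)| * x i := by
    rw [hfl]
    calc ∑ i, l i * x i ≤ ∑ i, |l i| * x i :=
          Finset.sum_le_sum fun i _ => mul_le_mul_of_nonneg_right (le_abs_self _) (hx0 i)
      _ = ∑ i, |l (σ (σ⁻¹ i))| * x i := by simp
      _ ≤ ∑ i, |l (σ i)| * x i :=
          (hσ.monovary hx).sum_comp_perm_mul_le_sum_mul (σ := σ⁻¹)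
  have h2 : ∑ i, |l (σ i)| * x i ≤ ∑ i, |l (σ i)| * y i := by
    have h0 : ∀ i : Fin m, 0 ≤ |l (σ i)| := fun i => abs_nonneg _
    have := sum_mul_nonneg_of_antitone (c := fun i => zeroExtend y i - zeroExtend x i)
      (zeroExtend_antitone hσ h0) (zeroExtend_nonneg h0) m
      (fun k hk => by rw [Finset.sum_sub_distrib, sub_nonneg]; exact h k hk)
    rw [← Fin.sum_univ_eq_sum_range
      (fun i => zeroExtend (fun i => |l (σ i)|) i * (zeroExtend y i - zeroExtend x i))] at this
    simp only [zeroExtend_val, mul_sub, Finset.sum_sub_distrib] at this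
    linarith
  have h3 := hf _ (subset_convexHull ℝ _ (Set.mem_range_self
    (σ.symm, fun i => if 0 ≤ l i then 1 else -1)))
  have hsign : ∀ a : ℝ, a * (((if 0 ≤ a then 1 else -1 : ℤˣ) : ℤ) : ℝ) = |a| := by
    intro a
    split_ifs with ha
    · simp [abs_of_nonneg ha]
    · simp [abs_of_neg (not_le.mp ha)]
  rw [hfl, ← Equiv.sum_comp σ] at h3
  simp only [Equiv.symm_apply_apply, ← mul_assoc, hsign] at h3
  linarith

/-! ### Antisymmetric powers and their operator norms. -/

section AntisymmetricPower

variable {n : Type*} {k : ℕ}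

/-- The compression of the `k`-th tensor power of `X` to the antisymmetric tensors, written as a
matrix on the whole tensor power. -/
noncomputable def antisymmPow (k : ℕ) (X : Matrix n n ℂ) : Matrix (Fin k → n) (Fin k → n) ℂ :=
  Matrix.of fun f g => (k.factorial : ℂ)⁻¹ * (X.submatrix f g).det

theorem antisymmPow_apply (X : Matrix n n ℂ) (f g : Fin k → n) :
    antisymmPow k X f g = (k.factorial : ℂ)⁻¹ * (X.submatrix f g).det := rfl

theorem continuous_antisymmPow : Continuous (antisymmPow k : Matrix n n ℂ → _) := by
  refine continuous_matrix fun f g => ?_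
  simp only [antisymmPow_apply]
  fun_prop

theorem antisymmPow_apply_of_not_injective (X : Matrix n n ℂ) {f g : Fin k → n}
    (hg : ¬ Function.Injective g) : antisymmPow k X f g = 0 := by
  simp only [Function.Injective, not_forall] at hg
  obtain ⟨i, j, hij, hne⟩ := hg
  rw [antisymmPow_apply, Matrix.det_zero_of_column_eq hne fun l => by simp [hij], mul_zero]

theorem antisymmPow_conjTranspose (X : Matrix n n ℂ) :
    antisymmPow k Xᴴ = (antisymmPow k X)ᴴ := by
  ext f g
  rw [Matrix.conjTranspose_apply, antisymmPow_apply, antisymmPow_apply,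
    ← Matrix.conjTranspose_submatrix, Matrix.det_conjTranspose]
  simp

variable [Fintype n]

/-- Cauchy–Binet summed over all maps `g`: non-injective ones contribute zero and each `k`-subset is
counted `k!` times. The normalization in `antisymmPow` absorbs this factor. -/
theorem sum_det_submatrix_mul_det_submatrix (X Y : Matrix n n ℂ) (f h : Fin k → n) :
    ∑ g : Fin k → n, (X.submatrix f g).det * (Y.submatrix g h).det =
      k.factorial * ((X * Y).submatrix f h).det := by
  have key : ∀ σ : Equiv.Perm (Fin k),
      ∑ g : Fin k → n, (∏ i, X (f (σ i)) (g i)) * (Y.submatrix g h).det =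
        ((X * Y).submatrix (f ∘ σ) h).det := by
    intro σ
    simp only [Matrix.det_apply' (Matrix.submatrix Y _ _), Matrix.det_apply' ((X * Y).submatrix _ _),
      Matrix.submatrix_apply, Matrix.mul_apply, Function.comp_apply, Finset.mul_sum]
    rw [Finset.sum_comm]
    have h1 : ∀ τ : Equiv.Perm (Fin k),
        ∏ i, ∑ j, X (f (σ (τ i))) j * Y j (h i) =
          ∑ g : Fin k → n, ∏ i, (X (f (σ (τ i))) (g (τ i)) * Y (g (τ i)) (h i)) := by
      intro τ
      rw [Finset.prod_univ_sum, Fintype.piFinset_univ]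
      exact (Fintype.sum_equiv (Equiv.arrowCongr τ.symm (Equiv.refl n)) _ _
        fun g => by simp [Equiv.arrowCongr]).symm
    refine Finset.sum_congr rfl fun τ _ => ?_
    rw [h1, Finset.mul_sum]
    refine Finset.sum_congr rfl fun g _ => ?_
    rw [Finset.prod_mul_distrib, Equiv.prod_comp τ fun i => X (f (σ i)) (g i)]
    ring
  simp_rw [Matrix.det_apply' (Matrix.submatrix X _ _), Finset.sum_mul]
  rw [Finset.sum_comm]
  calc _ = ∑ σ : Equiv.Perm (Fin k), (Equiv.Perm.sign σ : ℂ) *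
        ((X * Y).submatrix (f ∘ σ) h).det := by
        refine Finset.sum_congr rfl fun σ _ => ?_
        rw [← key σ, Finset.mul_sum]
        exact Finset.sum_congr rfl fun g _ => by simp [mul_assoc]
    _ = ∑ σ : Equiv.Perm (Fin k), ((X * Y).submatrix f h).det := by
        refine Finset.sum_congr rfl fun σ _ => ?_
        have := Matrix.det_permute σ ((X * Y).submatrix f h)
        rw [Matrix.submatrix_submatrix, Function.comp_id] at this
        rw [this, ← mul_assoc, ← Int.cast_mul, Int.units_coe_mul_self, Int.cast_one, one_mul]
    _ = _ := by simp [Fintype.card_perm]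

theorem antisymmPow_mul (X Y : Matrix n n ℂ) :
    antisymmPow k (X * Y) = antisymmPow k X * antisymmPow k Y := by
  ext f h
  have hk : (k.factorial : ℂ) ≠ 0 := Nat.cast_ne_zero.mpr k.factorial_ne_zero
  simp only [Matrix.mul_apply, antisymmPow_apply]
  calc _ = (k.factorial : ℂ)⁻¹ * (k.factorial : ℂ)⁻¹ *
        (k.factorial * ((X * Y).submatrix f h).det) := by field_simp
    _ = _ := by
        rw [← sum_det_submatrix_mul_det_submatrix, Finset.mul_sum]
        exact Finset.sum_congr rfl fun g _ => by ring

variable [DecidableEq n]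

theorem antisymmPow_diagonal (d : n → ℂ) :
    antisymmPow k (Matrix.diagonal d) =
      antisymmPow k 1 * Matrix.diagonal fun g : Fin k → n => ∏ i, d (g i) := by
  ext f g
  rw [Matrix.mul_diagonal, antisymmPow_apply, antisymmPow_apply, mul_assoc, mul_comm (Matrix.det _),
    ← Matrix.det_mul_row]
  congr 2
  ext i j
  by_cases hij : f i = g j <;> simp [Matrix.one_apply, hij]

open scoped Matrix.Norms.L2Operator

/-- The image of `1` is the orthogonal projection onto antisymmetric tensors, not the identity; it
vanishes when `k` exceeds the dimension. -/
theorem norm_antisymmPow_one_le : ‖antisymmPow k (1 : Matrix n n ℂ)‖ ≤ 1 := by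
  have h1 : (antisymmPow k (1 : Matrix n n ℂ))ᴴ * antisymmPow k (1 : Matrix n n ℂ) =
      antisymmPow k (1 : Matrix n n ℂ) := by
    rw [← antisymmPow_conjTranspose, ← antisymmPow_mul]; simp
  have h2 := Matrix.l2_opNorm_conjTranspose_mul_self (antisymmPow k (1 : Matrix n n ℂ))
  rw [h1] at h2
  by_contra! h
  nlinarith

theorem norm_antisymmPow_mul_le (X Y : Matrix n n ℂ) :
    ‖antisymmPow k (X * Y)‖ ≤ ‖antisymmPow k X‖ * ‖antisymmPow k Y‖ := by
  rw [antisymmPow_mul]; exact Matrix.l2_opNorm_mul _ _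

theorem norm_antisymmPow_conjTranspose (X : Matrix n n ℂ) :
    ‖antisymmPow k Xᴴ‖ = ‖antisymmPow k X‖ := by
  rw [antisymmPow_conjTranspose, Matrix.l2_opNorm_conjTranspose]

theorem norm_antisymmPow_conjTranspose_mul_self (X : Matrix n n ℂ) :
    ‖antisymmPow k (Xᴴ * X)‖ = ‖antisymmPow k X‖ ^ 2 := by
  rw [antisymmPow_mul, antisymmPow_conjTranspose, Matrix.l2_opNorm_conjTranspose_mul_self, sq]

theorem norm_antisymmPow_mul_conjTranspose_self (X : Matrix n n ℂ) :
    ‖antisymmPow k (X * Xᴴ)‖ = ‖antisymmPow k X‖ ^ 2 := by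
  simpa [norm_antisymmPow_conjTranspose] using norm_antisymmPow_conjTranspose_mul_self (k := k) Xᴴ

theorem norm_antisymmPow_le_one_of_mem_unitary {U : Matrix n n ℂ}
    (hU : U ∈ Matrix.unitaryGroup n ℂ) : ‖antisymmPow k U‖ ≤ 1 := by
  have h := norm_antisymmPow_conjTranspose_mul_self (k := k) U
  rw [← Matrix.star_eq_conjTranspose, Matrix.mem_unitaryGroup_iff'.mp hU] at h
  have h1 := norm_antisymmPow_one_le (n := n) (k := k)
  exact abs_le_one_iff_mul_self_le_one.mpr (by nlinarith) |> (le_abs_self _).trans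

theorem norm_antisymmPow_conj_le {U : Matrix n n ℂ} (hU : U ∈ Matrix.unitaryGroup n ℂ)
    (X : Matrix n n ℂ) : ‖antisymmPow k (U * X * star U)‖ ≤ ‖antisymmPow k X‖ := by
  have h1 := norm_antisymmPow_le_one_of_mem_unitary (k := k) hU
  have h2 := norm_antisymmPow_le_one_of_mem_unitary (k := k) (Unitary.star_mem hU)
  calc _ ≤ ‖antisymmPow k U‖ * ‖antisymmPow k X‖ * ‖antisymmPow k (star U)‖ :=
        (norm_antisymmPow_mul_le _ _).trans
          (mul_le_mul_of_nonneg_right (norm_antisymmPow_mul_le _ _) (norm_nonneg _))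
    _ ≤ 1 * ‖antisymmPow k X‖ * 1 := by gcongr
    _ = _ := by ring

theorem norm_antisymmPow_conj {U : Matrix n n ℂ} (hU : U ∈ Matrix.unitaryGroup n ℂ)
    (X : Matrix n n ℂ) : ‖antisymmPow k (U * X * star U)‖ = ‖antisymmPow k X‖ := by
  refine (norm_antisymmPow_conj_le hU X).antisymm ?_
  have h := norm_antisymmPow_conj_le (k := k) (Unitary.star_mem hU) (U * X * star U)
  have h1 : star U * (U * X * star U) * star (star U) = X := by
    rw [star_star]
    simp only [mul_assoc, Matrix.mem_unitaryGroup_iff'.mp hU, mul_one]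
    rw [← mul_assoc, Matrix.mem_unitaryGroup_iff'.mp hU, one_mul]
  rwa [h1] at h

theorem norm_antisymmPow_diagonal_le {x : n → ℝ} (hx : ∀ i, 0 ≤ x i) {c : ℝ} (hc : 0 ≤ c)
    (h : ∀ g : Fin k → n, Function.Injective g → ∏ i, x (g i) ≤ c) :
    ‖antisymmPow k (Matrix.diagonal fun i => (x i : ℂ))‖ ≤ c := by
  classical
  set d : (Fin k → n) → ℂ := fun g => if Function.Injective g then ∏ i, (x (g i) : ℂ) else 0
  have h1 : antisymmPow k (Matrix.diagonal fun i => (x i : ℂ)) =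
      antisymmPow k 1 * Matrix.diagonal d := by
    rw [antisymmPow_diagonal]
    ext f g
    by_cases hg : Function.Injective g
    · simp [d, hg]
    · simp [antisymmPow_apply_of_not_injective _ hg]
  rw [h1]
  refine (Matrix.l2_opNorm_mul _ _).trans ?_
  have h2 : ‖Matrix.diagonal d‖ ≤ c := by
    rw [Matrix.l2_opNorm_diagonal, pi_norm_le_iff_of_nonneg hc]
    intro g
    by_cases hg : Function.Injective g
    · simp only [d, hg, if_true, ← Complex.ofReal_prod]
      rw [Complex.norm_real, Real.norm_of_nonneg (Finset.prod_nonneg fun i _ => hx _)]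
      exact h g hg
    · simpa [d, hg] using hc
  calc _ ≤ 1 * c := by gcongr; exact norm_antisymmPow_one_le
    _ = c := one_mul c

theorem le_norm_antisymmPow_diagonal {x : n → ℝ} (hx : ∀ i, 0 ≤ x i) {g : Fin k → n}
    (hg : Function.Injective g) :
    ∏ i, x (g i) ≤ ‖antisymmPow k (Matrix.diagonal fun i => (x i : ℂ))‖ := by
  set P : Matrix (Fin k → n) (Fin k → n) ℂ := antisymmPow k 1
  set D := antisymmPow k (Matrix.diagonal fun i => (x i : ℂ)) with hD
  -- The only nonzero column of `v` is the antisymmetrized basis tensor of `g`, an eigenvector of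
  -- `D`; its entry at `g` is `1 / k!`.
  set v : Matrix (Fin k → n) (Fin k → n) ℂ := P * Matrix.single g g 1
  have h1 : D * v = ((∏ i, x (g i) : ℝ) : ℂ) • v := by
    have : D * P = D := by rw [hD, ← antisymmPow_mul, mul_one]
    simp only [v]
    rw [← mul_assoc, this, hD, antisymmPow_diagonal, mul_assoc, ← Matrix.mul_smul]
    congr 1
    ext a b
    by_cases ha : g = a
    · simp [Matrix.single_apply, Matrix.diagonal_mul, ha]
    · simp [Matrix.diagonal_mul, ha]
  have h2 : v ≠ 0 := by
    intro h0
    have h3 : v g g = 0 := by rw [h0]; rfl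
    have h4 : (1 : Matrix n n ℂ).submatrix g g = 1 := by
      ext i j
      simp [Matrix.one_apply, hg.eq_iff]
    simp [v, P, Matrix.mul_apply, Matrix.single_apply, antisymmPow_apply, h4,
      Nat.factorial_ne_zero] at h3
  have h3 := Matrix.l2_opNorm_mul D v
  rw [h1, norm_smul, Complex.norm_real,
    Real.norm_of_nonneg (Finset.prod_nonneg fun i _ => hx _)] at h3
  exact le_of_mul_le_mul_right h3 (norm_pos_iff.mpr h2)

/-- Listed increasingly from index `0`, the `i`-th element of a subset of `Fin m` is at least `i`.
-/
theorem prod_comp_injective_le {m : ℕ} {x : Fin m → ℝ} (hx0 : ∀ i, 0 ≤ x i) (hx : Antitone x)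
    (hk : k ≤ m) {g : Fin k → Fin m} (hg : Function.Injective g) :
    ∏ i, x (g i) ≤ ∏ i, x (Fin.castLE hk i) := by
  have hcard : (Finset.univ.image g).card = k := by
    rw [Finset.card_image_of_injective _ hg]; simp
  have h1 : ∏ i, x (g i) = ∏ i, x ((Finset.univ.image g).orderEmbOfFin hcard i) := by
    have h2 := Finset.prod_image (s := Finset.univ) (g := g) (f := x) hg.injOn
    rw [← h2]
    conv_lhs => rw [← Finset.image_orderEmbOfFin_univ (Finset.univ.image g) hcard]
    rw [Finset.prod_image (RelEmbedding.injective _).injOn]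
  rw [h1]
  refine Finset.prod_le_prod (fun i _ => hx0 _) fun i hi => hx ?_
  clear hi
  rw [Fin.le_def, Fin.val_castLE]
  have hmono := ((Finset.univ.image g).orderEmbOfFin hcard).strictMono
  obtain ⟨i, hi⟩ := i
  induction i with
  | zero => simp
  | succ j ih =>
    have h3 : (⟨j, by omega⟩ : Fin k) < ⟨j + 1, hi⟩ := by simp
    have h4 := hmono h3
    have h5 := ih (by omega)
    rw [Fin.lt_def] at h4
    exact h5.trans_lt h4

theorem norm_antisymmPow_diagonal {m : ℕ} {x : n → ℝ} (hx0 : ∀ i, 0 ≤ x i) (e : Fin m ≃ n)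
    (hx : Antitone (x ∘ e)) (hk : k ≤ m) :
    ‖antisymmPow k (Matrix.diagonal fun i => (x i : ℂ))‖ =
      ∏ i ∈ Finset.range k, zeroExtend (x ∘ e) i := by
  have h1 : ∏ i ∈ Finset.range k, zeroExtend (x ∘ e) i = ∏ i, x (e (Fin.castLE hk i)) := by
    rw [← Fin.prod_univ_eq_prod_range]
    exact Finset.prod_congr rfl fun i _ => zeroExtend_val (x ∘ e) (Fin.castLE hk i)
  rw [h1]
  refine le_antisymm (norm_antisymmPow_diagonal_le hx0 (Finset.prod_nonneg fun i _ => hx0 _) ?_)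
    (le_norm_antisymmPow_diagonal hx0 (e.injective.comp (Fin.castLE_injective hk)))
  intro g hg
  simpa using prod_comp_injective_le (fun i => hx0 (e i)) hx hk (e.symm.injective.comp hg)

end AntisymmetricPower

/-! ### Cordes' inequality in a C⋆-algebra. -/

section Cordes

open Filter Topology

variable {E : Type*} [CStarAlgebra E]

/-- `x * y` and `y * x` have the same nonzero spectrum, and the norm of a selfadjoint element is its
spectral radius. -/
theorem norm_mul_le_of_isSelfAdjoint_mul {x y : E} (h : IsSelfAdjoint (x * y)) :
    ‖x * y‖ ≤ ‖y * x‖ := by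
  nontriviality E
  have h1 : spectralRadius ℂ (x * y) ≤ spectralRadius ℂ (y * x) := by
    refine iSup₂_le fun z hz => ?_
    rcases eq_or_ne z 0 with rfl | hz0
    · simp
    · have h2 : z ∈ spectrum ℂ (x * y) \ {0} := ⟨hz, hz0⟩
      rw [spectrum.nonzero_mul_comm] at h2
      exact le_iSup₂ (f := fun z (_ : z ∈ spectrum ℂ (y * x)) => (‖z‖₊ : ENNReal)) z h2.1
  rw [h.spectralRadius_eq_nnnorm] at h1
  exact_mod_cast h1.trans (spectrum.spectralRadius_le_nnnorm _)

theorem dyadic_mem_of_midpoint_mem {S : Set ℝ} (h0 : (0 : ℝ) ∈ S) (h1 : (1 : ℝ) ∈ S)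
    (hmid : ∀ s ∈ S, ∀ t ∈ S, (s + t) / 2 ∈ S) (k j : ℕ) (hj : j ≤ 2 ^ k) :
    (j : ℝ) / 2 ^ k ∈ S := by
  induction k generalizing j with
  | zero =>
    rw [pow_zero] at hj
    interval_cases j <;> simpa
  | succ k ih =>
    have := hmid _ (ih (j / 2) (by omega)) _ (ih ((j + 1) / 2) (by omega))
    convert this using 1
    have h2 : (j : ℝ) = ((j / 2 : ℕ) : ℝ) + (((j + 1) / 2 : ℕ) : ℝ) := by
      norm_cast
      omega
    rw [h2]
    simp only [pow_succ]
    field_simp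

/-- Cordes' inequality for a pair of one-parameter semigroups of selfadjoint elements. -/
theorem norm_semigroup_mul_le_rpow {a b : ℝ → E} (ha : ∀ t, IsSelfAdjoint (a t))
    (hb : ∀ t, IsSelfAdjoint (b t))
    (ha_add : ∀ s t, 0 ≤ s → 0 ≤ t → a (s + t) = a s * a t)
    (hb_add : ∀ s t, 0 ≤ s → 0 ≤ t → b (s + t) = b s * b t)
    (ha_cont : ∀ t, 0 < t → ContinuousAt a t) (hb_cont : ∀ t, 0 < t → ContinuousAt b t)
    (h0 : ‖a 0 * b 0‖ ≤ 1) {t : ℝ} (ht0 : 0 < t) (ht1 : t ≤ 1) :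
    ‖a t * b t‖ ≤ ‖a 1 * b 1‖ ^ t := by
  set c := ‖a 1 * b 1‖
  have hc : 0 ≤ c := norm_nonneg _
  set S : Set ℝ := {t | 0 ≤ t ∧ ‖a t * b t‖ ≤ c ^ t}
  -- With `r` the midpoint, `‖a r * b r‖ ^ 2` is the norm of the selfadjoint `b r * a (s + t) * b
  -- r`. Cyclically moving a factor turns this product into `(a s * b s) * (b t * a t)`.
  have hmid : ∀ s ∈ S, ∀ t ∈ S, (s + t) / 2 ∈ S := by
    rintro s ⟨hs0, hs⟩ t ⟨ht0, ht⟩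
    have hm0 : 0 ≤ (s + t) / 2 := by linarith
    refine ⟨hm0, ?_⟩
    set r := (s + t) / 2 with hr
    have hrr : r + r = s + t := by rw [hr]; ring
    have h1 : ‖a r * b r‖ ^ 2 = ‖(b r * a t) * (a s * b r)‖ := by
      rw [sq, ← CStarRing.norm_star_mul_self, star_mul, (ha r).star_eq, (hb r).star_eq]
      congr 1
      rw [mul_assoc, ← mul_assoc (a r), ← ha_add _ _ hm0 hm0, hrr, add_comm, ha_add _ _ ht0 hs0]
      simp only [mul_assoc]
    have h2 : IsSelfAdjoint ((b r * a t) * (a s * b r)) := by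
      have : (b r * a t) * (a s * b r) = star (a r * b r) * (a r * b r) := by
        rw [star_mul, (ha r).star_eq, (hb r).star_eq, mul_assoc (b r) (a r), ← mul_assoc (a r),
          ← ha_add _ _ hm0 hm0, hrr, add_comm, ha_add _ _ ht0 hs0]
        simp only [mul_assoc]
      rw [this]
      exact IsSelfAdjoint.star_mul_self _
    have h3 : (a s * b r) * (b r * a t) = (a s * b s) * (b t * a t) := by
      rw [mul_assoc, ← mul_assoc (b r), ← hb_add _ _ hm0 hm0, hrr, hb_add _ _ hs0 ht0]
      simp only [mul_assoc]
    have h4 : ‖b t * a t‖ = ‖a t * b t‖ := by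
      rw [← norm_star, star_mul, (ha t).star_eq, (hb t).star_eq]
    have h5 : ‖a r * b r‖ ^ 2 ≤ (c ^ r) ^ 2 := by
      calc _ ≤ ‖a s * b s‖ * ‖b t * a t‖ := by
            rw [h1]
            exact (norm_mul_le_of_isSelfAdjoint_mul h2).trans (h3 ▸ norm_mul_le _ _)
        _ ≤ c ^ s * c ^ t := by
            rw [h4]
            gcongr
        _ = (c ^ r) ^ 2 := by
            rw [← Real.rpow_add_of_nonneg hc hs0 ht0, ← hrr, Real.rpow_add_of_nonneg hc hm0 hm0, sq]
    exact (pow_le_pow_iff_left₀ (norm_nonneg _) (Real.rpow_nonneg hc _) two_ne_zero).mp h5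
  have hS := dyadic_mem_of_midpoint_mem (S := S) ⟨le_rfl, by simpa using h0⟩
    ⟨zero_le_one, by simp [c]⟩ hmid
  -- Dyadic approximation of `t` requires continuity only at `t > 0`; powers of a singular matrix
  -- can jump at exponent `0`.
  have hlim : Tendsto (fun k : ℕ => (⌊t * 2 ^ k⌋₊ : ℝ) / 2 ^ k) atTop (𝓝 t) :=
    (tendsto_nat_floor_mul_div_atTop ht0.le).comp
      (tendsto_pow_atTop_atTop_of_one_lt (one_lt_two : (1 : ℝ) < 2))
  have hl : Tendsto (fun s => ‖a s * b s‖) (𝓝 t) (𝓝 ‖a t * b t‖) :=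
    ((ha_cont t ht0).mul (hb_cont t ht0)).norm
  have hrt : Tendsto (fun s => c ^ s) (𝓝 t) (𝓝 (c ^ t)) :=
    Real.continuousAt_const_rpow' ht0.ne'
  refine le_of_tendsto_of_tendsto' (hl.comp hlim) (hrt.comp hlim) fun k => (hS k _ ?_).2
  refine Nat.floor_le_of_le ?_
  push_cast
  exact mul_le_of_le_one_left (by positivity) ht1

end Cordes

/-! ### Spectral calculus for matrix powers and the sign of a Hermitian matrix. -/

section Diagonalization

variable {n : Type*} [Fintype n] [DecidableEq n]

/-- The enumeration of the index type along which Mathlib lists eigenvalues decreasingly. -/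
noncomputable def eigenvalueEquiv (n : Type*) [Fintype n] : Fin (Fintype.card n) ≃ n :=
  Fintype.equivOfCardEq (Fintype.card_fin _)

open scoped ComplexOrder in
theorem exists_diagonal_rpow {P : Matrix n n ℂ} (hP : 0 ≤ P) :
    ∃ U ∈ Matrix.unitaryGroup n ℂ, ∃ x : n → ℝ, (∀ i, 0 ≤ x i) ∧
      Antitone (x ∘ eigenvalueEquiv n) ∧
      P = U * Matrix.diagonal (fun i => (x i : ℂ)) * star U ∧
      ∀ t : ℝ, CFC.rpow P t = U * Matrix.diagonal (fun i => ((x i ^ t : ℝ) : ℂ)) * star U := by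
  have hpsd : P.PosSemidef := Matrix.nonneg_iff_posSemidef.mp hP
  refine ⟨hpsd.1.eigenvectorUnitary, hpsd.1.eigenvectorUnitary.2, hpsd.1.eigenvalues,
    hpsd.eigenvalues_nonneg, ?_, ?_, fun t => ?_⟩
  · intro i j hij
    simpa [Matrix.IsHermitian.eigenvalues, eigenvalueEquiv] using hpsd.1.eigenvalues₀_antitone hij
  · exact hpsd.1.spectral_theorem
  · rw [CFC.rpow_eq_pow, CFC.rpow_eq_cfc_real hP, hpsd.1.cfc_eq]
    rfl

theorem rpow_add_of_exponent_nonneg {P : Matrix n n ℂ} (hP : 0 ≤ P) {s t : ℝ} (hs : 0 ≤ s)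
    (ht : 0 ≤ t) : CFC.rpow P (s + t) = CFC.rpow P s * CFC.rpow P t := by
  obtain ⟨U, hU, x, hx0, -, -, hx⟩ := exists_diagonal_rpow hP
  have h : ∀ i, ((x i ^ (s + t) : ℝ) : ℂ) = ((x i ^ s : ℝ) : ℂ) * ((x i ^ t : ℝ) : ℂ) := fun i => by
    rw [Real.rpow_add_of_nonneg (hx0 i) hs ht, Complex.ofReal_mul]
  simp only [hx, h]
  rw [← Matrix.diagonal_mul_diagonal]
  simp only [mul_assoc]
  rw [← mul_assoc (star U) U, Matrix.mem_unitaryGroup_iff'.mp hU, one_mul]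

theorem continuousAt_matrix_rpow {P : Matrix n n ℂ} (hP : 0 ≤ P) {t : ℝ} (ht : 0 < t) :
    ContinuousAt (CFC.rpow P) t := by
  obtain ⟨U, hU, x, hx0, -, -, hx⟩ := exists_diagonal_rpow hP
  have : CFC.rpow P =
      fun t => U * Matrix.diagonal (fun i => ((x i ^ t : ℝ) : ℂ)) * star U := funext hx
  rw [this]
  have h : ContinuousAt (fun (t : ℝ) (i : n) => ((x i ^ t : ℝ) : ℂ)) t :=
    continuousAt_pi.mpr fun i =>
      Complex.continuous_ofReal.continuousAt.comp (Real.continuousAt_const_rpow' ht.ne')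
  have hc : Continuous fun d : n → ℂ => U * Matrix.diagonal d * star U := by fun_prop
  exact hc.continuousAt.comp h

theorem conjTranspose_rpow (P : Matrix n n ℂ) (t : ℝ) : (CFC.rpow P t)ᴴ = CFC.rpow P t :=
  (IsSelfAdjoint.of_nonneg (CFC.rpow_nonneg (a := P) (y := t))).star_eq

theorem exists_eq_sqrt_abs_mul_unitary_mul {B : Matrix n n ℂ} (hB : B.IsHermitian) :
    ∃ S ∈ Matrix.unitaryGroup n ℂ,
      B = CFC.rpow (CFC.abs B) (1 / 2) * S * CFC.rpow (CFC.abs B) (1 / 2) := by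
  have hsa : IsSelfAdjoint B := hB
  have hcont : ∀ f : ℝ → ℝ, ContinuousOn f (spectrum ℝ B) := fun f =>
    B.finite_real_spectrum.continuousOn f
  have hC : CFC.rpow (CFC.abs B) (1 / 2) = cfc (fun x : ℝ => |x| ^ (1 / 2 : ℝ)) B := by
    rw [CFC.rpow_eq_pow, CFC.rpow_eq_cfc_real (CFC.abs_nonneg B), CFC.abs_eq_cfc_norm B hsa,
      ← cfc_comp' (fun x : ℝ => x ^ (1 / 2 : ℝ)) (fun x : ℝ => ‖x‖) B
        (((Set.Finite.image _ B.finite_real_spectrum)).continuousOn _) (hcont _) hsa]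
    rfl
  -- The value `1` at `0` makes the sign of `B` unitary even when `B` is singular.
  set s : ℝ → ℝ := fun x => if 0 ≤ x then 1 else -1
  refine ⟨cfc s B, ?_, ?_⟩
  · rw [Matrix.mem_unitaryGroup_iff, ← cfc_star, ← cfc_mul _ _ B (hcont _) (hcont _)]
    rw [← cfc_one ℝ B hsa]
    refine cfc_congr fun x _ => ?_
    by_cases hx : 0 ≤ x <;> simp [s, hx]
  · rw [hC, ← cfc_mul _ _ B (hcont _) (hcont _), ← cfc_mul _ _ B (hcont _) (hcont _)]
    conv_lhs => rw [← cfc_id' ℝ B hsa]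
    refine cfc_congr fun x _ => ?_
    rw [mul_right_comm, ← Real.rpow_add_of_nonneg (abs_nonneg x) (by norm_num) (by norm_num)]
    norm_num
    by_cases hx : 0 ≤ x
    · simp [s, hx, abs_of_nonneg hx]
    · simp [s, hx, abs_of_neg (not_le.mp hx)]

end Diagonalization

/-! ### Weak log-majorization of the two matrices. -/

section LogMajorization

open scoped Matrix.Norms.L2Operator

variable {n : Type*} [Fintype n] [DecidableEq n] {k : ℕ}

theorem zeroExtend_rpow {m : ℕ} (x : Fin m → ℝ) {q : ℝ} (hq : q ≠ 0) (i : ℕ) :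
    zeroExtend (fun i => x i ^ q) i = zeroExtend x i ^ q := by
  unfold zeroExtend
  split_ifs
  · rfl
  · rw [Real.zero_rpow hq]

theorem norm_antisymmPow_rpow {P : Matrix n n ℂ} (hP : 0 ≤ P) {q : ℝ} (hq : 0 < q)
    (hk : k ≤ Fintype.card n) :
    ‖antisymmPow k (CFC.rpow P q)‖ = ‖antisymmPow k P‖ ^ q := by
  obtain ⟨U, hU, x, hx0, hanti, hPx, hx⟩ := exists_diagonal_rpow hP
  have h1 : Antitone ((fun i => x i ^ q) ∘ eigenvalueEquiv n) := fun i j hij =>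
    Real.rpow_le_rpow (hx0 _) (hanti hij) hq.le
  have h2 : ‖antisymmPow k P‖ = ∏ i ∈ Finset.range k, zeroExtend (x ∘ eigenvalueEquiv n) i := by
    rw [← norm_antisymmPow_diagonal hx0 _ hanti hk, ← norm_antisymmPow_conj hU (Matrix.diagonal _),
      ← hPx]
  rw [h2, hx, norm_antisymmPow_conj hU,
    norm_antisymmPow_diagonal (fun i => Real.rpow_nonneg (hx0 i) q) _ h1 hk,
    ← Real.finsetProd_rpow _ _ fun i _ => zeroExtend_nonneg (x := x ∘ eigenvalueEquiv n)
      (fun j => hx0 _) i]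
  exact Finset.prod_congr rfl fun i _ => zeroExtend_rpow (x ∘ eigenvalueEquiv n) hq.ne' i

theorem norm_antisymmPow_abs (X : Matrix n n ℂ) :
    ‖antisymmPow k (CFC.abs X)‖ = ‖antisymmPow k X‖ := by
  have h1 := norm_antisymmPow_conjTranspose_mul_self (k := k) (CFC.abs X)
  rw [← Matrix.star_eq_conjTranspose,
    (IsSelfAdjoint.of_nonneg (CFC.abs_nonneg X)).star_eq, CFC.abs_mul_abs,
    Matrix.star_eq_conjTranspose, norm_antisymmPow_conjTranspose_mul_self] at h1
  exact ((pow_left_inj₀ (norm_nonneg _) (norm_nonneg _) two_ne_zero).mp h1).symm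

/-- The norm depends on `A` only through `Aᴴ * A`, which is unchanged when `A` becomes its modulus.
-/
theorem norm_antisymmPow_mul_eq_abs_mul (A C : Matrix n n ℂ) (hC : Cᴴ = C) :
    ‖antisymmPow k (A * C)‖ = ‖antisymmPow k (CFC.abs A * C)‖ := by
  have h : ∀ X : Matrix n n ℂ, (X * C)ᴴ * (X * C) = C * (star X * X) * C := fun X => by
    rw [Matrix.conjTranspose_mul, hC, Matrix.star_eq_conjTranspose]
    simp only [mul_assoc]
  have h1 := norm_antisymmPow_conjTranspose_mul_self (k := k) (A * C)
  have h2 := norm_antisymmPow_conjTranspose_mul_self (k := k) (CFC.abs A * C)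
  rw [h, ← CFC.abs_mul_abs] at h1
  rw [h, (IsSelfAdjoint.of_nonneg (CFC.abs_nonneg A)).star_eq, h1] at h2
  exact (pow_left_inj₀ (norm_nonneg _) (norm_nonneg _) two_ne_zero).mp h2

theorem norm_antisymmPow_conj_hermitian_le (A : Matrix n n ℂ) {B : Matrix n n ℂ}
    (hB : B.IsHermitian) :
    ‖antisymmPow k (A * B * Aᴴ)‖ ≤
      ‖antisymmPow k (CFC.abs A * CFC.rpow (CFC.abs B) (1 / 2))‖ ^ 2 := by
  obtain ⟨S, hS, hBS⟩ := exists_eq_sqrt_abs_mul_unitary_mul hB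
  set C := CFC.rpow (CFC.abs B) (1 / 2) with hCdef
  have hC : Cᴴ = C := conjTranspose_rpow _ _
  have h1 : A * B * Aᴴ = A * C * S * (A * C)ᴴ := by
    rw [Matrix.conjTranspose_mul, hC]
    conv_lhs => rw [hBS]
    simp only [mul_assoc]
  have hS1 := norm_antisymmPow_le_one_of_mem_unitary (k := k) hS
  rw [h1, ← norm_antisymmPow_mul_eq_abs_mul A C hC]
  calc _ ≤ ‖antisymmPow k (A * C)‖ * ‖antisymmPow k S‖ * ‖antisymmPow k (A * C)ᴴ‖ :=
        (norm_antisymmPow_mul_le _ _).trans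
          (mul_le_mul_of_nonneg_right (norm_antisymmPow_mul_le _ _) (norm_nonneg _))
    _ ≤ ‖antisymmPow k (A * C)‖ * 1 * ‖antisymmPow k (A * C)ᴴ‖ := by gcongr
    _ = _ := by rw [norm_antisymmPow_conjTranspose]; ring

theorem norm_antisymmPow_mul_sqrt_le {P Q : Matrix n n ℂ} (hP : 0 ≤ P) (hQ : 0 ≤ Q) {q : ℝ}
    (hq : 1 ≤ q) :
    ‖antisymmPow k (P * CFC.rpow Q (1 / 2))‖ ≤
      ‖antisymmPow k (CFC.rpow P q * CFC.rpow Q (q / 2))‖ ^ (1 / q) := by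
  have hq0 : 0 < q := by linarith
  have hcont : ∀ {R : Matrix n n ℂ}, 0 ≤ R → ∀ c : ℝ, 0 < c → ∀ t : ℝ, 0 < t →
      ContinuousAt (fun t => antisymmPow k (CFC.rpow R (c * t))) t := fun hR c hc t ht =>
    continuous_antisymmPow.continuousAt.comp
      (ContinuousAt.comp (f := fun t => c * t) (continuousAt_matrix_rpow hR (mul_pos hc ht))
        (by fun_prop))
  have hadd : ∀ {R : Matrix n n ℂ}, 0 ≤ R → ∀ c : ℝ, 0 < c → ∀ s t : ℝ, 0 ≤ s → 0 ≤ t →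
      antisymmPow k (CFC.rpow R (c * (s + t))) =
        antisymmPow k (CFC.rpow R (c * s)) * antisymmPow k (CFC.rpow R (c * t)) :=
    fun hR c hc s t hs ht => by
      rw [mul_add, rpow_add_of_exponent_nonneg hR (by positivity) (by positivity), antisymmPow_mul]
  have hsa : ∀ (R : Matrix n n ℂ) (c t : ℝ),
      IsSelfAdjoint (antisymmPow k (CFC.rpow R (c * t))) := fun R c t => by
    rw [isSelfAdjoint_iff, Matrix.star_eq_conjTranspose, ← antisymmPow_conjTranspose,
      conjTranspose_rpow]
  -- The exponents are scaled so that time `1` gives `P^q` and `Q^(q/2)`, while time `1/q` gives `P`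
  -- and `Q^(1/2)`.
  have key := norm_semigroup_mul_le_rpow
    (a := fun t => antisymmPow k (CFC.rpow P (q * t)))
    (b := fun t => antisymmPow k (CFC.rpow Q (q / 2 * t)))
    (fun t => hsa P q t) (fun t => hsa Q (q / 2) t) (hadd hP q hq0) (hadd hQ (q / 2) (by positivity))
    (hcont hP q hq0) (hcont hQ (q / 2) (by positivity))
    (by
      rw [← antisymmPow_mul]
      simp only [mul_zero, CFC.rpow_eq_pow, CFC.rpow_zero P hP, CFC.rpow_zero Q hQ, mul_one]
      exact norm_antisymmPow_one_le)
    (t := 1 / q) (by positivity) ((div_le_one hq0).mpr hq)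
  have h1 : q * (1 / q) = 1 := by field_simp
  have h2 : q / 2 * (1 / q) = 1 / 2 := by field_simp
  simp only [h1, h2, mul_one, ← antisymmPow_mul] at key
  have h3 : CFC.rpow P 1 = P := CFC.rpow_one P hP
  rwa [h3] at key

/-- The weak log-majorization of `|A B Aᴴ| ^ q` by `|A| ^ q |B| ^ q |A| ^ q`. -/
theorem norm_antisymmPow_matrixAbsPow_le (A : Matrix n n ℂ) {B : Matrix n n ℂ}
    (hB : B.IsHermitian) {q : ℝ} (hq : 1 ≤ q) (hk : k ≤ Fintype.card n) :
    ‖antisymmPow k (matrixAbsPow (A * B * Aᴴ) q)‖ ≤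
      ‖antisymmPow k (matrixAbsPow A q * matrixAbsPow B q * matrixAbsPow A q)‖ := by
  have hq0 : 0 < q := by linarith
  unfold matrixAbsPow
  rw [norm_antisymmPow_rpow (CFC.abs_nonneg (A * B * Aᴴ)) hq0 hk, norm_antisymmPow_abs]
  set G := CFC.rpow (CFC.abs A) q * CFC.rpow (CFC.abs B) (q / 2) with hG
  have h1 : CFC.rpow (CFC.abs A) q * CFC.rpow (CFC.abs B) q * CFC.rpow (CFC.abs A) q = G * Gᴴ := by
    rw [hG, Matrix.conjTranspose_mul, conjTranspose_rpow, conjTranspose_rpow]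
    have : CFC.rpow (CFC.abs B) q = CFC.rpow (CFC.abs B) (q / 2) * CFC.rpow (CFC.abs B) (q / 2) := by
      rw [← rpow_add_of_exponent_nonneg (CFC.abs_nonneg B) (by positivity) (by positivity),
        add_halves]
    rw [this]
    simp only [mul_assoc]
  rw [h1, norm_antisymmPow_mul_conjTranspose_self]
  have h2 := norm_antisymmPow_mul_sqrt_le (k := k) (CFC.abs_nonneg A) (CFC.abs_nonneg B) hq
  have h3 : ‖antisymmPow k (A * B * Aᴴ)‖ ≤ (‖antisymmPow k G‖ ^ (1 / q)) ^ 2 :=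
    (norm_antisymmPow_conj_hermitian_le A hB).trans (pow_le_pow_left₀ (norm_nonneg _) h2 2)
  have h4 : ((‖antisymmPow k G‖ ^ (1 / q)) ^ 2) ^ q = ‖antisymmPow k G‖ ^ 2 := by
    have h5 := norm_nonneg (antisymmPow k G)
    have h6 : 1 / q * ((2 : ℕ) : ℝ) * q = (2 : ℕ) := by field_simp
    rw [← Real.rpow_natCast, ← Real.rpow_mul h5, ← Real.rpow_mul h5, h6, Real.rpow_natCast]
  exact (Real.rpow_le_rpow (norm_nonneg _) h3 hq0.le).trans_eq h4

end LogMajorization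

/-! ### Fan dominance for unitarily invariant norms. -/

section FanDominance

variable {n : Type*} [Fintype n] [DecidableEq n] {N : Matrix n n ℂ → ℝ}

theorem IsUnitarilyInvariantNorm.conj (hN : IsUnitarilyInvariantNorm N) {U : Matrix n n ℂ}
    (hU : U ∈ Matrix.unitaryGroup n ℂ) (X : Matrix n n ℂ) : N (U * X * star U) = N X :=
  hN.unitary_mul_mul U hU _ (Unitary.star_mem hU) X

theorem IsUnitarilyInvariantNorm.signed_perm (hN : IsUnitarilyInvariantNorm N) (d : n → ℂ)
    (π : Equiv.Perm n) (ε : n → ℤˣ) :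
    N (Matrix.diagonal fun i => ((ε i : ℤ) : ℂ) * d (π i)) = N (Matrix.diagonal d) := by
  set S : Matrix n n ℂ := Matrix.diagonal fun i => ((ε i : ℤ) : ℂ)
  set Q : Matrix n n ℂ := π.permMatrix ℂ
  have hQ : Q ∈ Matrix.unitaryGroup n ℂ := by
    rw [Matrix.mem_unitaryGroup_iff', Matrix.star_eq_conjTranspose, Matrix.conjTranspose_permMatrix,
      ← Matrix.permMatrix_mul, mul_inv_cancel, Matrix.permMatrix_one]
  have hS : S ∈ Matrix.unitaryGroup n ℂ := by
    rw [Matrix.mem_unitaryGroup_iff, Matrix.star_eq_conjTranspose, Matrix.diagonal_conjTranspose,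
      Matrix.diagonal_mul_diagonal, ← Matrix.diagonal_one]
    congr 1
    ext i
    rcases Int.units_eq_one_or (ε i) with h | h <;> simp [h]
  have h1 : Matrix.diagonal (fun i => ((ε i : ℤ) : ℂ) * d (π i)) =
      (S * Q) * Matrix.diagonal d * star Q := by
    rw [Matrix.star_eq_conjTranspose, Matrix.conjTranspose_permMatrix]
    simp only [S, Q, Equiv.Perm.permMatrix, mul_assoc, PEquiv.mul_toMatrix_toPEquiv]
    have hπ : π⁻¹.symm = π := rfl
    ext i j
    by_cases hij : i = j <;>
      simp [hπ, hij]
  rw [h1]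
  exact hN.unitary_mul_mul _ (mul_mem hS hQ) _ (Unitary.star_mem hQ) _

theorem IsUnitarilyInvariantNorm.convexOn_diagonal (hN : IsUnitarilyInvariantNorm N) {m : ℕ}
    (e : Fin m ≃ n) :
    ConvexOn ℝ Set.univ
      fun v : Fin m → ℝ => N (Matrix.diagonal fun i => ((v (e.symm i) : ℝ) : ℂ)) := by
  refine ⟨convex_univ, fun v _ w _ a b ha hb _ => ?_⟩
  have h1 : (Matrix.diagonal fun i => (((a • v + b • w) (e.symm i) : ℝ) : ℂ)) =
      (a : ℂ) • Matrix.diagonal (fun i => ((v (e.symm i) : ℝ) : ℂ)) +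
        (b : ℂ) • Matrix.diagonal (fun i => ((w (e.symm i) : ℝ) : ℂ)) := by
    rw [← Matrix.diagonal_smul, ← Matrix.diagonal_smul, Matrix.diagonal_add]
    congr 1
    ext i
    simp
  simp only [h1]
  refine (hN.add_le _ _).trans ?_
  rw [hN.smul_eq, hN.smul_eq, Complex.norm_real, Complex.norm_real, Real.norm_of_nonneg ha,
    Real.norm_of_nonneg hb]
  simp

/-- Fan dominance for diagonal matrices. -/
theorem IsUnitarilyInvariantNorm.diagonal_le (hN : IsUnitarilyInvariantNorm N) {m : ℕ}
    (e : Fin m ≃ n) {x y : n → ℝ} (hx0 : ∀ i, 0 ≤ x i) (hx : Antitone (x ∘ e))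
    (h : ∀ k ≤ m, ∑ i ∈ Finset.range k, zeroExtend (x ∘ e) i ≤
      ∑ i ∈ Finset.range k, zeroExtend (y ∘ e) i) :
    N (Matrix.diagonal fun i => (x i : ℂ)) ≤ N (Matrix.diagonal fun i => (y i : ℂ)) := by
  -- A convex function on a convex hull is bounded by its value at some generator; here all
  -- generators give the same norm, by unitary invariance.
  obtain ⟨_, ⟨⟨σ, ε⟩, rfl⟩, hle⟩ :=
    (hN.convexOn_diagonal e).exists_ge_of_mem_convexHull (Set.subset_univ _)
      (mem_convexHull_signed_perm (fun i => hx0 (e i)) hx h)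
  have h1 := hN.signed_perm (fun i => (y i : ℂ)) ((e.symm.trans σ).trans e) (ε ∘ e.symm)
  simp only [Function.comp_apply, Equiv.apply_symm_apply, Complex.ofReal_mul,
    Complex.ofReal_intCast] at hle
  simp only [Function.comp_apply, Equiv.trans_apply] at h1
  exact hle.trans_eq h1

theorem IsUnitarilyInvariantNorm.le_of_norm_antisymmPow_le (hN : IsUnitarilyInvariantNorm N)
    {P Q : Matrix n n ℂ} (hP : 0 ≤ P) (hQ : 0 ≤ Q)
    (h : open scoped Matrix.Norms.L2Operator in
      ∀ k ≤ Fintype.card n, ‖antisymmPow k P‖ ≤ ‖antisymmPow k Q‖) : N P ≤ N Q := by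
  obtain ⟨U, hU, x, hx0, hx, hPx, -⟩ := exists_diagonal_rpow hP
  obtain ⟨V, hV, y, hy0, hy, hQy, -⟩ := exists_diagonal_rpow hQ
  rw [hPx, hQy, hN.conj hU, hN.conj hV]
  refine hN.diagonal_le (eigenvalueEquiv n) hx0 hx fun k hk => ?_
  refine sum_range_le_of_prod_range_le (zeroExtend_antitone hx fun i => hx0 _)
    (zeroExtend_nonneg fun i => hx0 _) (zeroExtend_nonneg fun i => hy0 _) k fun j hj => ?_
  have h1 := h j (hj.trans hk)
  rwa [hPx, hQy, norm_antisymmPow_conj hU, norm_antisymmPow_conj hV,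
    norm_antisymmPow_diagonal hx0 _ hx (hj.trans hk),
    norm_antisymmPow_diagonal hy0 _ hy (hj.trans hk)] at h1

end FanDominance

theorem proposition3 {n : Type*} [Fintype n] [DecidableEq n]
    (N : Matrix n n ℂ → ℝ) (hN : IsUnitarilyInvariantNorm N)
    (A B : Matrix n n ℂ) (hB : B.IsHermitian) (q : ℝ) (hq : 1 ≤ q) :
    N (matrixAbsPow (A * B * Aᴴ) q) ≤
      N (matrixAbsPow A q * matrixAbsPow B q * matrixAbsPow A q) := by
  refine hN.le_of_norm_antisymmPow_le CFC.rpow_nonneg ?_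
    fun k hk => norm_antisymmPow_matrixAbsPow_le A hB hq hk
  -- Fan dominance is applied to positive semidefinite matrices; the right-hand product is one, as a
  -- conjugate of `|B|^q` by the Hermitian `|A|^q`.
  have h := star_left_conjugate_nonneg (CFC.rpow_nonneg (a := CFC.abs B) (y := q))
    (matrixAbsPow A q)
  have h1 : star (matrixAbsPow A q) = matrixAbsPow A q := conjTranspose_rpow _ _
  rwa [h1] at h
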